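/- Let $\Delta\ge 3$ be an integer, let $\lambda>0$, and let $\alpha,\beta>0$ satisfy $\alpha+\beta+\Delta(\Delta-2)\alpha\beta\le 1$ and $\alpha,\beta\le 1/2$. With the convention $0\ln 0=0$, put $H(x)=-x\ln x-(1-x)\ln(1-x)$ and $H_1(x,y)=-x(\ln x-\ln y)+(x-y)(\ln(y-x)-\ln y)$ (with $H_1(0,0)=0$), and define \begin{align*} g_{\alpha,\beta}(\gamma,\delta,\varepsilon)=\Phi_2(\alpha,\beta,\gamma,\delta,\varepsilon)={}&2(\alpha+\beta)\ln\lambda+H(\alpha)+H_1(\gamma,\alpha)+H_1(\alpha-\gamma,1-\alpha)\\ &+H(\beta)+H_1(\delta,\beta)+H_1(\beta-\delta,1-\beta)\\ &+\Delta\Big(H_1(\gamma,1-2\beta+\delta)-H(\gamma)+H_1(\varepsilon,1-2\beta+\delta-\gamma)\\ &\qquad+H_1(\alpha-\gamma-\varepsilon,\beta-\delta)-H_1(\alpha-\gamma,1-\gamma)\\ &\qquad+H_1(\alpha-\gamma,1-\beta-\gamma-\varepsilon)-H_1(\alpha-\gamma,1-\alpha)\Big) \end{align*} on the region of all $(\gamma,\delta,\varepsilon)\in\mathbb{R}^3$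 with \begin{gather*} \gamma,\delta,\varepsilon\ge 0,\quad \alpha-\gamma-\varepsilon\ge 0,\quad \beta-\delta\ge 0,\quad 1-2\beta+\delta-\gamma-\varepsilon\ge 0,\\ 1-\alpha-\beta-\varepsilon\ge 0,\quad \beta-\delta+\varepsilon+\gamma-\alpha\ge 0. \end{gather*} Then the point $(\gamma^*,\delta^*,\varepsilon^*)=(\alpha^2,\beta^2,\alpha(1-\alpha-\beta))$ lies in this region, and $g_{\alpha,\beta}$ achieves its unique maximum over the region there: $g_{\alpha,\beta}(\gamma,\delta,\varepsilon)<g_{\alpha,\beta}(\gamma^*,\delta^*,\varepsilon^*)$ for every other point $(\gamma,\delta,\varepsilon)$ of the region. -/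

import Mathlib

noncomputable section

namespace HardCore

/-- `H₁(x, y) = -x (ln x - ln y) + (x - y) (ln (y - x) - ln y)`.
Since `Real.log 0 = 0`, the convention `0 ln 0 = 0` holds. -/
def H₁ (x y : ℝ) : ℝ :=
  -x * (Real.log x - Real.log y) + (x - y) * (Real.log (y - x) - Real.log y)

/-- The second moment exponent `Φ₂(α, β, γ, δ, ε)` at degree `Δ` and activity `lam`;
`Real.binEntropy x = - x ln x - (1 - x) ln (1 - x)`. -/
def Φ₂ (Δ : ℕ) (lam α β γ δ ε : ℝ) : ℝ :=
  2 * (α + β) * Real.log lam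
    + Real.binEntropy α + H₁ γ α + H₁ (α - γ) (1 - α)
    + Real.binEntropy β + H₁ δ β + H₁ (β - δ) (1 - β)
    + (Δ : ℝ) *
      (H₁ γ (1 - 2 * β + δ) - Real.binEntropy γ + H₁ ε (1 - 2 * β + δ - γ)
        + H₁ (α - γ - ε) (β - δ) - H₁ (α - γ) (1 - γ)
        + H₁ (α - γ) (1 - β - γ - ε) - H₁ (α - γ) (1 - α))

/-- The region `R_Δ` of pairs `(α, β)`. -/
def regionR (Δ : ℕ) : Set (ℝ × ℝ) :=
  {p | 0 < p.1 ∧ 0 < p.2 ∧ p.1 + p.2 + (Δ : ℝ) * ((Δ : ℝ) - 2) * p.1 * p.2 ≤ 1}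

/-- The region of triples `(γ, δ, ε)` on which `Φ₂(α, β, ·)` is considered. -/
def overlapRegion (α β : ℝ) : Set (ℝ × ℝ × ℝ) :=
  {p | match p with
    | (γ, δ, ε) =>
      0 ≤ γ ∧ 0 ≤ δ ∧ 0 ≤ ε ∧ 0 ≤ α - γ - ε ∧ 0 ≤ β - δ ∧
      0 ≤ 1 - 2 * β + δ - γ - ε ∧ 0 ≤ 1 - α - β - ε ∧ 0 ≤ β - δ + ε + γ - α}

/-- `g_{α,β}(γ, δ, ε) = Φ₂(α, β, γ, δ, ε)`, as a function of the triple `(γ, δ, ε)`. -/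
def g (Δ : ℕ) (lam α β : ℝ) (p : ℝ × ℝ × ℝ) : ℝ :=
  Φ₂ Δ lam α β p.1 p.2.1 p.2.2

end HardCore

end

namespace HardCore

open Real

/-! `Φ₂` splits into a constant, one overlap entropy per side, and `Δ` times a matching exponent
(`Φ₂_eq`). Each overlap entropy falls below its product value by at least an explicit quadratic in
`γ - α ^ 2` or `δ - β ^ 2` (`overlapEntropy_add_le`). The matching exponent exceeds its product
value by at most a multiple of `(γ - α ^ 2) * (δ - β ^ 2)`, by Gibbs' inequality against independent
edges (`matchingExponent_le`). The resulting quadratic form is positive definite (`quadratic_pos`),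
which forces `γ` and `δ`; strictness in Gibbs then forces `ε`. -/

/-! ### Logarithmic inequalities for entropy terms. -/

/-- A Padé-type lower bound for the logarithm, of fourth order contact at `1`. -/
theorem rational_le_log {x : ℝ} (hx : 0 < x) :
    (x - 1) * (5 * x + 1) / (2 * x * (x + 2)) ≤ log x := by
  set f : ℝ → ℝ := fun y => log y - (y - 1) * (5 * y + 1) / (2 * y * (y + 2)) with hf
  have hderiv : ∀ y : ℝ, 0 < y → HasDerivAt f ((y - 1) ^ 3 / (y ^ 2 * (y + 2) ^ 2)) y := by
    intro y hy
    have hden : 2 * y * (y + 2) ≠ 0 := by positivity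
    have hnum : HasDerivAt (fun y : ℝ => (y - 1) * (5 * y + 1))
        (1 * (5 * y + 1) + (y - 1) * (5 * 1)) y :=
      ((hasDerivAt_id y).sub_const 1).mul (((hasDerivAt_id y).const_mul 5).add_const 1)
    have hden' : HasDerivAt (fun y : ℝ => 2 * y * (y + 2)) (2 * 1 * (y + 2) + 2 * y * 1) y :=
      ((hasDerivAt_id y).const_mul 2).mul ((hasDerivAt_id y).add_const 2)
    refine ((hasDerivAt_log hy.ne').sub (hnum.div hden' hden)).congr_deriv ?_
    have : y + 2 ≠ 0 := by positivity
    field_simp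
    ring
  have hf1 : f 1 = 0 := by simp [hf]
  suffices 0 ≤ f x by simpa [hf] using this
  rw [← hf1]
  rcases le_total x 1 with h | h
  · have hanti : AntitoneOn f (Set.Icc x 1) := by
      refine antitoneOn_of_deriv_nonpos (convex_Icc x 1)
        (fun y hy => (hderiv y (hx.trans_le hy.1)).continuousAt.continuousWithinAt)
        (fun y hy => ?_) (fun y hy => ?_)
      all_goals rw [interior_Icc] at hy
      · exact (hderiv y (hx.trans hy.1)).differentiableAt.differentiableWithinAt
      · rw [(hderiv y (hx.trans hy.1)).deriv]
        refine div_nonpos_of_nonpos_of_nonneg ?_ (by positivity)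
        exact Odd.pow_nonpos (by decide) (by linarith [hy.2])
    exact hanti ⟨le_rfl, h⟩ ⟨h, le_rfl⟩ h
  · have hmono : MonotoneOn f (Set.Icc 1 x) := by
      refine monotoneOn_of_deriv_nonneg (convex_Icc 1 x)
        (fun y hy => (hderiv y (one_pos.trans_le hy.1)).continuousAt.continuousWithinAt)
        (fun y hy => ?_) (fun y hy => ?_)
      all_goals rw [interior_Icc] at hy
      · exact (hderiv y (one_pos.trans hy.1)).differentiableAt.differentiableWithinAt
      · rw [(hderiv y (one_pos.trans hy.1)).deriv]
        have : 0 ≤ y - 1 := by linarith [hy.1]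
        positivity
    exact hmono ⟨le_rfl, h⟩ ⟨h, le_rfl⟩ h

/-- A quadratic lower bound for one term of a relative entropy. -/
theorem negMulLog_add_mul_log_le {x y : ℝ} (hx : 0 ≤ x) (hy : 0 < y) :
    negMulLog x + x * log y + 3 * (x - y) ^ 2 / (2 * (2 * y + x)) ≤ y - x := by
  rcases hx.eq_or_lt with rfl | hx
  · simp only [negMulLog_zero]
    have : 3 * (0 - y) ^ 2 / (2 * (2 * y + 0)) = 3 / 4 * y := by field_simp; ring
    rw [this]; linarith
  · have h := mul_le_mul_of_nonneg_left (rational_le_log (div_pos hx hy)) hx.le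
    rw [log_div hx.ne' hy.ne'] at h
    have e : x * ((x / y - 1) * (5 * (x / y) + 1) / (2 * (x / y) * (x / y + 2)))
        = x - y + 3 * (x - y) ^ 2 / (2 * (2 * y + x)) := by
      have : x + 2 * y ≠ 0 := by positivity
      have : 2 * y + x ≠ 0 := by positivity
      field_simp
      ring
    rw [e] at h
    simp only [negMulLog]
    linarith

/-- Gibbs' inequality for one term. -/
theorem gibbs_term {t x y k : ℝ} (ht : 0 ≤ t) (hx : t ≤ x) (hy : t ≤ y) (hk : 0 < k) :
    negMulLog t + t * (log x + log y + log k) ≤ k * x * y - t := by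
  -- At `t = 0` the logarithms are multiplied by zero, so `x = 0` or `y = 0` is harmless; for `t >
  -- 0` both are positive.
  rcases ht.eq_or_lt with rfl | ht
  · simp only [negMulLog_zero]
    have : 0 ≤ k * x * y := by positivity
    linarith
  · have hx' := ht.trans_le hx
    have hy' := ht.trans_le hy
    have h := mul_le_mul_of_nonneg_left
      (log_le_sub_one_of_pos (show 0 < k * x * y / t by positivity)) ht.le
    rw [log_div (by positivity) ht.ne', log_mul (by positivity) hy'.ne',
      log_mul hk.ne' hx'.ne', mul_sub t (k * x * y / t), mul_div_cancel₀ _ ht.ne'] at h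
    simp only [negMulLog]
    linarith

/-- The equality case of Gibbs' inequality for one term. -/
theorem gibbs_term_lt {t x y k : ℝ} (ht : 0 ≤ t) (hx : 0 < x) (hy : 0 < y) (hk : 0 < k)
    (hne : t ≠ k * x * y) :
    negMulLog t + t * (log x + log y + log k) < k * x * y - t := by
  rcases ht.eq_or_lt with rfl | ht
  · simp only [negMulLog_zero]
    have : 0 < k * x * y := by positivity
    linarith
  · have hne' : k * x * y / t ≠ 1 := by
      rw [Ne, div_eq_one_iff_eq ht.ne']; exact hne.symm
    have h := mul_lt_mul_of_pos_left
      (log_lt_sub_one_of_pos (show 0 < k * x * y / t by positivity) hne') ht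
    rw [log_div (by positivity) ht.ne', log_mul (by positivity) hy.ne',
      log_mul hk.ne' hx.ne', mul_sub t (k * x * y / t), mul_div_cancel₀ _ ht.ne'] at h
    simp only [negMulLog]
    linarith

/-! ### Quadratic deficit of the overlap entropy. -/

/-- The entropy of a pair of bits with means `α` that are both `1` with probability `γ`. -/
noncomputable def overlapEntropy (α γ : ℝ) : ℝ :=
  negMulLog γ + 2 * negMulLog (α - γ) + negMulLog (1 - 2 * α + γ)

theorem overlapEntropy_sq {α : ℝ} : overlapEntropy α (α ^ 2) = 2 * binEntropy α := by
  rw [overlapEntropy, binEntropy_eq_negMulLog_add_negMulLog_one_sub,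
    show α ^ 2 = α * α by ring, show α - α * α = α * (1 - α) by ring,
    show 1 - 2 * α + α * α = (1 - α) * (1 - α) by ring]
  simp only [negMulLog_mul]
  ring

/-- Makes the denominators of the termwise entropy bounds independent of `γ`. Equality holds at `α =
1 / 2`, `γ = 1 / 4`. -/
theorem one_div_le_sum_one_div {α γ : ℝ} (h0 : 0 < α) (h1 : α < 1) (hγ : 0 ≤ γ) (hγα : γ ≤ α)
    (hγ' : 0 ≤ 1 - 2 * α + γ) :
    1 / (α * (1 - α) * (1 - α * (1 - α))) ≤
      1 / (2 * α ^ 2 + γ) + 2 / (2 * (α * (1 - α)) + (α - γ))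
        + 1 / (2 * (1 - α) ^ 2 + (1 - 2 * α + γ)) := by
  have hA : 0 < 1 - α := by linarith
  have hs : 0 < α * (1 - α) := by positivity
  have hs4 : 0 ≤ 1 - 4 * (α * (1 - α)) := by nlinarith [sq_nonneg (1 - 2 * α)]
  -- `ξ` is the correlation of the two bits.
  obtain ⟨ξ, hξ⟩ : ∃ ξ, γ = α ^ 2 + α * (1 - α) * ξ :=
    ⟨(γ - α ^ 2) / (α * (1 - α)), by field_simp; ring⟩
  have hξ1 : ξ ≤ 1 := by
    by_contra! h
    nlinarith [mul_pos hs (sub_pos.2 h)]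
  have hξ2 : -1 ≤ ξ := by
    by_contra! h
    nlinarith [mul_pos hs (sub_pos.2 h), sq_nonneg (1 - 2 * α)]
  have d1 : 0 < 2 * α ^ 2 + γ := by positivity
  have d2 : 0 < 2 * (α * (1 - α)) + (α - γ) := by linarith
  have d3 : 0 < 2 * (1 - α) ^ 2 + (1 - 2 * α + γ) := by positivity
  have d4 : 0 < 1 - α * (1 - α) := by linarith
  rw [div_add_div _ _ d1.ne' d2.ne', div_add_div _ _ (by positivity) d3.ne',
    div_le_div_iff₀ (by positivity) (by positivity)]
  -- This is the difference of the cross-multiplied sides, arranged so that every factor is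
  -- nonnegative.
  have key : 0 ≤ (α * (1 - α)) ^ 2 * ((1 - 4 * (α * (1 - α))) * (9 - 6 * ξ + 3 * ξ ^ 2)
      + α * (1 - α) * ξ ^ 2 * (3 + ξ)) := by
    have : 0 ≤ 9 - 6 * ξ + 3 * ξ ^ 2 := by nlinarith [sq_nonneg (ξ - 1)]
    have : 0 ≤ 3 + ξ := by linarith
    positivity
  rw [← sub_nonneg]
  refine key.trans_eq ?_
  rw [hξ]
  ring

/-- The termwise bound is applied relative to two independent bits; the linear terms cancel because
both laws have mass one. -/
theorem overlapEntropy_add_le {α γ : ℝ} (h0 : 0 < α) (h1 : α < 1) (hγ : 0 ≤ γ) (hγα : γ ≤ α)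
    (hγ' : 0 ≤ 1 - 2 * α + γ) :
    overlapEntropy α γ
        + 3 / 2 * (γ - α ^ 2) ^ 2 / (α * (1 - α) * (1 - α * (1 - α)))
      ≤ 2 * binEntropy α := by
  have hA : 0 < 1 - α := by linarith
  have e1 := negMulLog_add_mul_log_le hγ (show 0 < α ^ 2 by positivity)
  have e2 := negMulLog_add_mul_log_le (sub_nonneg.2 hγα) (show 0 < α * (1 - α) by positivity)
  have e3 := negMulLog_add_mul_log_le hγ' (show 0 < (1 - α) ^ 2 by positivity)
  have r := mul_le_mul_of_nonneg_left (one_div_le_sum_one_div h0 h1 hγ hγα hγ')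
    (show 0 ≤ 3 / 2 * (γ - α ^ 2) ^ 2 by positivity)
  rw [log_pow, Nat.cast_ofNat] at e1 e3
  rw [log_mul h0.ne' hA.ne'] at e2
  rw [overlapEntropy, binEntropy_eq_negMulLog_add_negMulLog_one_sub]
  have q2 : α - γ - α * (1 - α) = -(γ - α ^ 2) := by ring
  have q3 : 1 - 2 * α + γ - (1 - α) ^ 2 = γ - α ^ 2 := by ring
  rw [q2, neg_sq] at e2
  rw [q3] at e3
  have r' : 3 / 2 * (γ - α ^ 2) ^ 2 / (α * (1 - α) * (1 - α * (1 - α))) ≤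
      3 * (γ - α ^ 2) ^ 2 / (2 * (2 * α ^ 2 + γ))
        + 2 * (3 * (γ - α ^ 2) ^ 2 / (2 * (2 * (α * (1 - α)) + (α - γ))))
        + 3 * (γ - α ^ 2) ^ 2 / (2 * (2 * (1 - α) ^ 2 + (1 - 2 * α + γ))) := by
    refine le_trans (le_of_eq ?_) (r.trans (le_of_eq ?_))
    · ring
    · simp only [div_eq_mul_inv, mul_inv]
      ring
  have hl : 2 * (negMulLog α + negMulLog (1 - α)) =
      -(γ * (2 * log α) + 2 * ((α - γ) * (log α + log (1 - α)))
        + (1 - 2 * α + γ) * (2 * log (1 - α))) := by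
    simp only [negMulLog]; ring
  rw [hl]
  linarith

/-! ### The matching exponent and Gibbs' inequality. -/

/-- The exponent of the probability that a uniform perfect matching respects two hard-core
configurations with densities `α`, `β` and overlaps `γ`, `δ`, where `ε` is the density of the
edges from the first configuration's left-only vertices to vertices in neither configuration. -/
noncomputable def matchingExponent (α β γ δ ε : ℝ) : ℝ :=
  negMulLog ε + negMulLog (1 - 2 * β + δ - γ - ε) + negMulLog (α - γ - ε)
    + negMulLog (β - δ + ε + γ - α) + negMulLog (1 - α - β - ε) - negMulLog (1 - β - γ - ε)
    - negMulLog (α - γ) - negMulLog (1 - 2 * α + γ) - negMulLog (β - δ)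
    - negMulLog (1 - 2 * β + δ)

theorem H₁_eq (x y : ℝ) : H₁ x y = negMulLog x + negMulLog (y - x) - negMulLog y := by
  simp only [H₁, negMulLog]; ring

theorem Φ₂_eq (Δ : ℕ) (lam α β γ δ ε : ℝ) :
    Φ₂ Δ lam α β γ δ ε = 2 * (α + β) * log lam + overlapEntropy α γ + overlapEntropy β δ
      + Δ * matchingExponent α β γ δ ε := by
  simp only [Φ₂, H₁_eq, binEntropy_eq_negMulLog_add_negMulLog_one_sub, overlapEntropy,
    matchingExponent]
  rw [show 1 - α - (α - γ) = 1 - 2 * α + γ by ring, show 1 - β - (β - δ) = 1 - 2 * β + δ by ring,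
    show β - δ - (α - γ - ε) = β - δ + ε + γ - α by ring, show 1 - γ - (α - γ) = 1 - α by ring,
    show 1 - β - γ - ε - (α - γ) = 1 - α - β - ε by ring]
  ring

theorem matchingExponent_product (α β : ℝ) :
    matchingExponent α β (α ^ 2) (β ^ 2) (α * (1 - α - β)) =
      2 * (negMulLog (1 - α - β) - negMulLog (1 - α) - negMulLog (1 - β)) := by
  rw [matchingExponent,
    show 1 - 2 * β + β ^ 2 - α ^ 2 - α * (1 - α - β) = (1 - β) * (1 - α - β) by ring,
    show α - α ^ 2 - α * (1 - α - β) = α * β by ring,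
    show β - β ^ 2 + α * (1 - α - β) + α ^ 2 - α = β * (1 - α - β) by ring,
    show 1 - α - β - α * (1 - α - β) = (1 - α) * (1 - α - β) by ring,
    show 1 - β - α ^ 2 - α * (1 - α - β) = (1 - α) * (1 - β) by ring,
    show α - α ^ 2 = α * (1 - α) by ring, show β - β ^ 2 = β * (1 - β) by ring,
    show 1 - 2 * α + α ^ 2 = (1 - α) * (1 - α) by ring,
    show 1 - 2 * β + β ^ 2 = (1 - β) * (1 - β) by ring]
  simp only [negMulLog_mul]
  ring

/-- The entropy of a product table with total mass `a + a'`. -/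
theorem negMulLog_product_table {a a' b b' : ℝ} (ha : 0 ≤ a) (ha' : 0 ≤ a') (hb : 0 ≤ b)
    (hb' : 0 ≤ b') (h : a + a' = b + b') :
    negMulLog (a * b / (a + a')) + negMulLog (a * b' / (a + a')) + negMulLog (a' * b / (a + a'))
        + negMulLog (a' * b' / (a + a'))
      = negMulLog a + negMulLog a' + negMulLog b + negMulLog b' - negMulLog (a + a') := by
  rcases (add_nonneg ha ha').eq_or_lt with hN | hN
  · obtain rfl : a = 0 := by linarith
    obtain rfl : a' = 0 := by linarith
    obtain rfl : b = 0 := by linarith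
    obtain rfl : b' = 0 := by linarith
    simp
  · obtain ⟨N, hNdef⟩ : ∃ N, N = a + a' := ⟨_, rfl⟩
    rw [← hNdef] at hN h ⊢
    have hinv : negMulLog N⁻¹ = N⁻¹ * log N := by simp [negMulLog]
    have hlog : negMulLog N = -N * log N := rfl
    simp only [div_eq_mul_inv, negMulLog_mul, hinv, hlog]
    obtain rfl : a' = N - a := by linarith
    obtain rfl : b' = N - b := by linarith
    field_simp
    ring

section Gibbs

variable {α β γ δ ε : ℝ}

/-- The slack `s` in the Gibbs term of `ε` is carried through, so that one computation yields both
the weak and the strict bound. -/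
theorem matchingExponent_add_le (hα : 0 < α) (hβ : 0 < β) (hw : 0 < 1 - α - β)
    (hp : (γ, δ, ε) ∈ overlapRegion α β) {s : ℝ}
    (hs : negMulLog ε + ε * (log (α - γ) + log (1 - 2 * β + δ)
        + log ((1 - α - β) / ((1 - α) * (1 - β) ^ 2)))
      + s ≤ (1 - α - β) / ((1 - α) * (1 - β) ^ 2) * (α - γ) * (1 - 2 * β + δ) - ε) :
    matchingExponent α β γ δ ε + s ≤
      matchingExponent α β (α ^ 2) (β ^ 2) (α * (1 - α - β))
        + (γ - α ^ 2) * (δ - β ^ 2) / ((1 - α) ^ 2 * (1 - β) ^ 2) := by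
  obtain ⟨hγ, hδ, hε, hη, hb, hS, hM, hτ⟩ := hp
  have hA : 0 < 1 - α := by linarith
  have hB : 0 < 1 - β := by linarith
  have ha : 0 ≤ α - γ := by linarith
  have hNdef : α - γ + (1 - α - β - ε) = 1 - β - γ - ε := by ring
  have hN : 0 ≤ 1 - β - γ - ε := by linarith
  have tab := negMulLog_product_table ha hM hb hS (by ring)
  rw [hNdef] at tab
  have frac : ∀ x y z : ℝ, 0 ≤ x → 0 ≤ y → x ≤ z → y ≤ z → 0 ≤ x * y / z ∧
      x * y / z ≤ x ∧ x * y / z ≤ y := by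
    intro x y z hx hy hxz hyz
    have hz := hx.trans hxz
    refine ⟨by positivity, ?_, ?_⟩
    · exact div_le_of_le_mul₀ hz hx (by gcongr)
    · rw [mul_comm x y]; exact div_le_of_le_mul₀ hz hy (by gcongr)
  obtain ⟨p1, p2, p3⟩ := frac (α - γ) (β - δ) (1 - β - γ - ε) ha hb (by linarith) (by linarith)
  obtain ⟨q1, q2, q3⟩ := frac (α - γ) (1 - 2 * β + δ - γ - ε) (1 - β - γ - ε) ha hS (by linarith) (by linarith)
  obtain ⟨r1, r2, r3⟩ := frac (1 - α - β - ε) (β - δ) (1 - β - γ - ε) hM hb (by linarith) (by linarith)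
  obtain ⟨u1, u2, u3⟩ :=
    frac (1 - α - β - ε) (1 - 2 * β + δ - γ - ε) (1 - β - γ - ε) hM hS (by linarith) (by linarith)
  -- If the total mass is zero, the quotients are `0` by convention and the marginals vanish too.
  have sp : (α - γ) * (β - δ) / (1 - β - γ - ε) + (α - γ) * (1 - 2 * β + δ - γ - ε) / (1 - β - γ - ε) = α - γ := by
    rcases hN.eq_or_lt with h | h
    · rw [← h]; simp; linarith
    · field_simp; ring
  have sr : (1 - α - β - ε) * (β - δ) / (1 - β - γ - ε) + (1 - α - β - ε) * (1 - 2 * β + δ - γ - ε) / (1 - β - γ - ε)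
      = 1 - α - β - ε := by
    rcases hN.eq_or_lt with h | h
    · rw [← h]; simp; linarith
    · field_simp; ring
  have sb : (α - γ) * (β - δ) / (1 - β - γ - ε) + (1 - α - β - ε) * (β - δ) / (1 - β - γ - ε) = β - δ := by
    rcases hN.eq_or_lt with h | h
    · rw [← h]; simp; linarith
    · field_simp; ring
  set t1 := (α - γ) * (β - δ) / (1 - β - γ - ε)
  set t2 := (α - γ) * (1 - 2 * β + δ - γ - ε) / (1 - β - γ - ε)
  set t3 := (1 - α - β - ε) * (β - δ) / (1 - β - γ - ε)
  set t4 := (1 - α - β - ε) * (1 - 2 * β + δ - γ - ε) / (1 - β - γ - ε)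
  -- The nine cells are the edge types allowed by both configurations. For one configuration, the
  -- edge law over the product of its marginals is `1 / (1 - β)`, `1 / (1 - α)` or `(1 - α - β) /
  -- ((1 - α) * (1 - β))`; each `k` is a product of two of these.
  have g1 := gibbs_term (k := 1 / (1 - β) ^ 2) (x := γ) (y := 1 - 2 * β + δ) hγ le_rfl
    (by linarith) (by positivity)
  have g3 := gibbs_term (k := 1 / ((1 - α) * (1 - β))) (x := α - γ) (y := β - δ) hη
    (by linarith) (by linarith) (by positivity)
  have g4 := gibbs_term (k := 1 / ((1 - α) * (1 - β))) p1 p2 p3 (by positivity)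
  have g5 := gibbs_term (k := (1 - α - β) / ((1 - α) * (1 - β) ^ 2)) (x := α - γ) (y := 1 - 2 * β + δ)
    q1 q2 (by linarith) (by positivity)
  have g6 := gibbs_term (k := 1 / (1 - α) ^ 2) (x := 1 - 2 * α + γ) (y := δ) hδ
    (by linarith) le_rfl (by positivity)
  have g7 := gibbs_term (k := (1 - α - β) / ((1 - α) ^ 2 * (1 - β))) (x := 1 - 2 * α + γ) (y := β - δ)
    r1 (by linarith) r3 (by positivity)
  have g8 := gibbs_term (k := (1 - α - β) / ((1 - α) ^ 2 * (1 - β))) (x := 1 - 2 * α + γ) (y := β - δ)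
    hτ (by linarith) (by linarith) (by positivity)
  have g9 := gibbs_term (k := (1 - α - β) ^ 2 / ((1 - α) ^ 2 * (1 - β) ^ 2)) (x := 1 - 2 * α + γ)
    (y := 1 - 2 * β + δ) u1 (by linarith) (by linarith) (by positivity)
  have hA' := hA.ne'
  have hB' := hB.ne'
  -- The reference masses need not sum to one; their excess is the bilinear error term.
  have total : 1 / (1 - β) ^ 2 * γ * (1 - 2 * β + δ)
      + 2 * ((1 - α - β) / ((1 - α) * (1 - β) ^ 2) * (α - γ) * (1 - 2 * β + δ))
      + 2 * (1 / ((1 - α) * (1 - β)) * (α - γ) * (β - δ))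
      + 1 / (1 - α) ^ 2 * (1 - 2 * α + γ) * δ
      + 2 * ((1 - α - β) / ((1 - α) ^ 2 * (1 - β)) * (1 - 2 * α + γ) * (β - δ))
      + (1 - α - β) ^ 2 / ((1 - α) ^ 2 * (1 - β) ^ 2) * (1 - 2 * α + γ) * (1 - 2 * β + δ)
      = 1 + (γ - α ^ 2) * (δ - β ^ 2) / ((1 - α) ^ 2 * (1 - β) ^ 2) := by
    field_simp
    ring
  have l1 : log (1 / (1 - β) ^ 2) = -2 * log (1 - β) := by
    rw [log_div one_ne_zero (by positivity), log_pow]; simp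
  have l6 : log (1 / (1 - α) ^ 2) = -2 * log (1 - α) := by
    rw [log_div one_ne_zero (by positivity), log_pow]; simp
  have l3 : log (1 / ((1 - α) * (1 - β))) = -log (1 - α) - log (1 - β) := by
    rw [log_div one_ne_zero (by positivity), log_mul hA' hB']; simp; ring
  have l2 : log ((1 - α - β) / ((1 - α) * (1 - β) ^ 2)) = log (1 - α - β) - log (1 - α) - 2 * log (1 - β) := by
    rw [log_div hw.ne' (by positivity), log_mul hA' (by positivity), log_pow]; push_cast; ring
  have l7 : log ((1 - α - β) / ((1 - α) ^ 2 * (1 - β))) = log (1 - α - β) - 2 * log (1 - α) - log (1 - β) := by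
    rw [log_div hw.ne' (by positivity), log_mul (by positivity) hB', log_pow]; push_cast; ring
  have l9 : log ((1 - α - β) ^ 2 / ((1 - α) ^ 2 * (1 - β) ^ 2))
      = 2 * log (1 - α - β) - 2 * log (1 - α) - 2 * log (1 - β) := by
    rw [log_div (by positivity) (by positivity), log_mul (by positivity) (by positivity),
      log_pow, log_pow, log_pow]; push_cast; ring
  rw [l1] at g1
  rw [l2] at hs g5
  rw [l3] at g3 g4
  rw [l6] at g6
  rw [l7] at g7 g8
  rw [l9] at g9
  have t2e : t2 = α - γ - t1 := by linarith
  have t3e : t3 = β - δ - t1 := by linarith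
  have t4e : t4 = 1 - α - β - ε - (β - δ - t1) := by linarith
  -- Only the marginals of the table enter here, so `ε` and `t1` cancel.
  have logs : γ * (log γ + log (1 - 2 * β + δ) + -2 * log (1 - β))
      + ε * (log (α - γ) + log (1 - 2 * β + δ) + (log (1 - α - β) - log (1 - α) - 2 * log (1 - β)))
      + (α - γ - ε) * (log (α - γ) + log (β - δ) + (-log (1 - α) - log (1 - β)))
      + t1 * (log (α - γ) + log (β - δ) + (-log (1 - α) - log (1 - β)))
      + t2 * (log (α - γ) + log (1 - 2 * β + δ) + (log (1 - α - β) - log (1 - α) - 2 * log (1 - β)))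
      + δ * (log (1 - 2 * α + γ) + log δ + -2 * log (1 - α))
      + t3 * (log (1 - 2 * α + γ) + log (β - δ) + (log (1 - α - β) - 2 * log (1 - α) - log (1 - β)))
      + (β - δ + ε + γ - α) *
          (log (1 - 2 * α + γ) + log (β - δ) + (log (1 - α - β) - 2 * log (1 - α) - log (1 - β)))
      + t4 * (log (1 - 2 * α + γ) + log (1 - 2 * β + δ)
          + (2 * log (1 - α - β) - 2 * log (1 - α) - 2 * log (1 - β)))
      = -(negMulLog γ + 2 * negMulLog (α - γ) + negMulLog (1 - 2 * α + γ)
          + negMulLog δ + 2 * negMulLog (β - δ) + negMulLog (1 - 2 * β + δ))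
        - 2 * (negMulLog (1 - α - β) - negMulLog (1 - α) - negMulLog (1 - β)) := by
    rw [t2e, t3e, t4e]
    simp only [negMulLog]
    ring
  rw [matchingExponent_product, matchingExponent]
  linarith

theorem matchingExponent_le (hα : 0 < α) (hβ : 0 < β) (hw : 0 < 1 - α - β)
    (hp : (γ, δ, ε) ∈ overlapRegion α β) :
    matchingExponent α β γ δ ε ≤
      matchingExponent α β (α ^ 2) (β ^ 2) (α * (1 - α - β))
        + (γ - α ^ 2) * (δ - β ^ 2) / ((1 - α) ^ 2 * (1 - β) ^ 2) := by
  have hA : 0 < 1 - α := by linarith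
  have hB : 0 < 1 - β := by linarith
  have h := gibbs_term (t := ε) (x := α - γ) (y := 1 - 2 * β + δ)
    (k := (1 - α - β) / ((1 - α) * (1 - β) ^ 2)) hp.2.2.1
    (by linarith [hp.2.2.2.1]) (by linarith [hp.2.2.2.2.2.1, hp.1]) (by positivity)
  simpa using matchingExponent_add_le (s := 0) hα hβ hw hp (by simpa using h)

theorem matchingExponent_lt (hα : 0 < α) (hβ : 0 < β) (hw : 0 < 1 - α - β)
    (hp : (α ^ 2, β ^ 2, ε) ∈ overlapRegion α β) (hε : ε ≠ α * (1 - α - β)) :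
    matchingExponent α β (α ^ 2) (β ^ 2) ε <
      matchingExponent α β (α ^ 2) (β ^ 2) (α * (1 - α - β)) := by
  have hA : 0 < 1 - α := by linarith
  have hB : 0 < 1 - β := by linarith
  have ea : α - α ^ 2 = α * (1 - α) := by ring
  have eb : 1 - 2 * β + β ^ 2 = (1 - β) ^ 2 := by ring
  have h := gibbs_term_lt (t := ε) (x := α - α ^ 2) (y := 1 - 2 * β + β ^ 2)
    (k := (1 - α - β) / ((1 - α) * (1 - β) ^ 2)) hp.2.2.1
    (by rw [ea]; positivity) (by rw [eb]; positivity) (by positivity)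
    (by rw [ea, eb]; convert hε using 1; field_simp)
  have := matchingExponent_add_le hα hβ hw hp (s := _) (by rw [← le_sub_iff_add_le'])
  simp only [sub_self, zero_mul, zero_div, add_zero] at this
  linarith

end Gibbs

theorem product_mem_overlapRegion {α β : ℝ} (hα : 0 < α) (hβ : 0 < β) (hw : 0 < 1 - α - β) :
    (α ^ 2, β ^ 2, α * (1 - α - β)) ∈ overlapRegion α β := by
  have hA : 0 < 1 - α := by linarith
  have hB : 0 < 1 - β := by linarith
  have := mul_pos hα hβ
  have := mul_pos hα hw
  have := mul_pos hβ hw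
  have := mul_pos hA hw
  have := mul_pos hB hw
  have := mul_pos hβ hB
  refine ⟨by positivity, by positivity, by positivity, ?_, ?_, ?_, ?_, ?_⟩ <;> nlinarith

/-! ### Positive definiteness of the quadratic form. -/

/-- The determinant condition behind `quadratic_pos`. -/
theorem discriminant_lt {α β : ℝ} (hα : 0 < α) (hβ : 0 < β) (hα' : α ≤ 1 / 2)
    (hβ' : β ≤ 1 / 2) (h : 4 * (α * β) ≤ (1 - α) * (1 - β)) :
    (1 - α * (1 - α)) * (1 - β * (1 - β)) < 4 * ((1 - α) ^ 2 * (1 - β) ^ 2) := by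
  have hA : 0 < 1 - α := by linarith
  have hB : 0 < 1 - β := by linarith
  -- In the odds `o, p ≤ 1` the claim becomes `key`; `(1 - o) * (1 - p) ≥ 0` bounds its left side by
  -- `3 * (1 + m + m ^ 2)` with `m = o * p ≤ 1 / 4`.
  obtain ⟨o, ho⟩ : ∃ o, α = o * (1 - α) := ⟨α / (1 - α), by field_simp⟩
  obtain ⟨p, hp⟩ : ∃ p, β = p * (1 - β) := ⟨β / (1 - β), by field_simp⟩
  have hAB : 0 < (1 - α) * (1 - β) := by positivity
  have ho0 : 0 < o := by by_contra! h'; nlinarith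
  have hp0 : 0 < p := by by_contra! h'; nlinarith
  have ho1 : o ≤ 1 := by by_contra! h'; nlinarith
  have hp1 : p ≤ 1 := by by_contra! h'; nlinarith
  have hm : o * p ≤ 1 / 4 := by
    have e : α * β = o * p * ((1 - α) * (1 - β)) := by
      calc α * β = (o * (1 - α)) * (p * (1 - β)) := by rw [← ho, ← hp]
        _ = _ := by ring
    by_contra! h'
    nlinarith
  have ea : 1 - α * (1 - α) = (1 + o + o ^ 2) * (1 - α) ^ 2 := by
    linear_combination (α + o * (1 - α) + (1 - α)) * ho
  have eb : 1 - β * (1 - β) = (1 + p + p ^ 2) * (1 - β) ^ 2 := by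
    linear_combination (β + p * (1 - β) + (1 - β)) * hp
  have hs : o + p ≤ 1 + o * p := by nlinarith
  have hm0 : 0 < o * p := by positivity
  have key : (1 + o + o ^ 2) * (1 + p + p ^ 2) < 4 := by
    have e : (1 + o + o ^ 2) * (1 + p + p ^ 2)
        = 1 + (o + p) + (o + p) ^ 2 - o * p + o * p * (o + p) + (o * p) ^ 2 := by ring
    have h1 : (o + p) ^ 2 ≤ (1 + o * p) ^ 2 := by gcongr
    have h2 : o * p * (o + p) ≤ o * p * (1 + o * p) := by gcongr
    nlinarith
  rw [ea, eb]
  calc _ = (1 + o + o ^ 2) * (1 + p + p ^ 2) * ((1 - α) ^ 2 * (1 - β) ^ 2) := by ring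
    _ < _ := by gcongr

theorem quadratic_pos {Δ α β : ℝ} (hΔ : 3 ≤ Δ) (hα : 0 < α) (hβ : 0 < β) (hα' : α ≤ 1 / 2)
    (hβ' : β ≤ 1 / 2) (hR : α + β + Δ * (Δ - 2) * α * β ≤ 1) {v u : ℝ} (hvu : v ≠ 0 ∨ u ≠ 0) :
    Δ * (v * u / ((1 - α) ^ 2 * (1 - β) ^ 2)) <
      3 / 2 * v ^ 2 / (α * (1 - α) * (1 - α * (1 - α)))
        + 3 / 2 * u ^ 2 / (β * (1 - β) * (1 - β * (1 - β))) := by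
  have hA : 0 < 1 - α := by linarith
  have hB : 0 < 1 - β := by linarith
  have hαβ : 0 < α * β := by positivity
  -- The region condition with `α * β` added to both sides.
  have hR' : (Δ - 1) ^ 2 * (α * β) ≤ (1 - α) * (1 - β) := by nlinarith
  have h4 : 4 * (α * β) ≤ (1 - α) * (1 - β) := by
    refine le_trans ?_ hR'
    gcongr
    nlinarith
  have hd := discriminant_lt hα hβ hα' hβ' h4
  -- Uses `Δ / (Δ - 1) ≤ 3 / 2`, an equality at `Δ = 3`.
  have hΔ2 : 4 * (Δ ^ 2 * (α * β)) ≤ 9 * ((1 - α) * (1 - β)) := by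
    have : 4 * Δ ^ 2 ≤ 9 * (Δ - 1) ^ 2 := by nlinarith
    nlinarith
  have hsα : 0 < 1 - α * (1 - α) := by nlinarith
  have hsβ : 0 < 1 - β * (1 - β) := by nlinarith
  set P := 3 / 2 / (α * (1 - α) * (1 - α * (1 - α))) with hP
  set Q := 3 / 2 / (β * (1 - β) * (1 - β * (1 - β))) with hQ
  set K := Δ / ((1 - α) ^ 2 * (1 - β) ^ 2) with hK
  have hP0 : 0 < P := by positivity
  have hQ0 : 0 < Q := by positivity
  have hdet : K ^ 2 < 4 * P * Q := by
    have e : 4 * P * Q = 9 / (α * (1 - α) * (1 - α * (1 - α))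
        * (β * (1 - β) * (1 - β * (1 - β)))) := by
      rw [hP, hQ]; field_simp; ring
    rw [e, hK, div_pow, div_lt_div_iff₀ (by positivity) (by positivity)]
    calc Δ ^ 2 * (α * (1 - α) * (1 - α * (1 - α)) * (β * (1 - β) * (1 - β * (1 - β))))
        = (Δ ^ 2 * (α * β)) * ((1 - α) * (1 - β)
            * ((1 - α * (1 - α)) * (1 - β * (1 - β)))) := by ring
      _ ≤ (9 / 4 * ((1 - α) * (1 - β))) * ((1 - α) * (1 - β)
            * ((1 - α * (1 - α)) * (1 - β * (1 - β)))) :=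
          mul_le_mul_of_nonneg_right (by linarith) (by positivity)
      _ < (9 / 4 * ((1 - α) * (1 - β))) * ((1 - α) * (1 - β)
            * (4 * ((1 - α) ^ 2 * (1 - β) ^ 2))) := by gcongr
      _ = _ := by ring
  have hpos : 0 < P * v ^ 2 - K * (v * u) + Q * u ^ 2 := by
    have h4P : 0 < 4 * P * (P * v ^ 2 - K * (v * u) + Q * u ^ 2) := by
      have e : 4 * P * (P * v ^ 2 - K * (v * u) + Q * u ^ 2)
          = (2 * P * v - K * u) ^ 2 + (4 * P * Q - K ^ 2) * u ^ 2 := by ring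
      rw [e]
      have hd' : 0 < 4 * P * Q - K ^ 2 := by linarith
      by_cases hu : u = 0
      · have hv : v ≠ 0 := by tauto
        subst hu
        have : 0 < (2 * P * v) ^ 2 := by positivity
        simpa using this
      · positivity
    exact pos_of_mul_pos_right h4P (by positivity)
  have e1 : Δ * (v * u / ((1 - α) ^ 2 * (1 - β) ^ 2)) = K * (v * u) := by rw [hK]; ring
  have e2 : 3 / 2 * v ^ 2 / (α * (1 - α) * (1 - α * (1 - α))) = P * v ^ 2 := by rw [hP]; ring
  have e3 : 3 / 2 * u ^ 2 / (β * (1 - β) * (1 - β * (1 - β))) = Q * u ^ 2 := by rw [hQ]; ring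
  rw [e1, e2, e3]
  linarith

end HardCore

/-! ### The unique maximum. -/

theorem lemma6 (Δ : ℕ) (hΔ : 3 ≤ Δ) (lam : ℝ) (hlam : 0 < lam) (α β : ℝ)
    (hR : (α, β) ∈ HardCore.regionR Δ) (hα : α ≤ 1 / 2) (hβ : β ≤ 1 / 2) :
    (α ^ 2, β ^ 2, α * (1 - α - β)) ∈ HardCore.overlapRegion α β ∧
      ∀ p ∈ HardCore.overlapRegion α β, p ≠ (α ^ 2, β ^ 2, α * (1 - α - β)) →
        HardCore.g Δ lam α β p <
          HardCore.g Δ lam α β (α ^ 2, β ^ 2, α * (1 - α - β)) := by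
  obtain ⟨hα0, hβ0, hR⟩ := hR
  dsimp only at hα0 hβ0 hR
  have hΔ' : (3 : ℝ) ≤ Δ := by exact_mod_cast hΔ
  have hw : 0 < 1 - α - β := by
    have h2 : (0 : ℝ) < (Δ : ℝ) - 2 := by linarith
    have : 0 < (Δ : ℝ) * ((Δ : ℝ) - 2) * α * β := by positivity
    linarith
  refine ⟨HardCore.product_mem_overlapRegion hα0 hβ0 hw, ?_⟩
  rintro ⟨γ, δ, ε⟩ hp hne
  simp only [HardCore.g, HardCore.Φ₂_eq, HardCore.overlapEntropy_sq]
  by_cases hvu : γ - α ^ 2 ≠ 0 ∨ δ - β ^ 2 ≠ 0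
  · have hM := mul_le_mul_of_nonneg_left (HardCore.matchingExponent_le hα0 hβ0 hw hp)
      (show (0 : ℝ) ≤ Δ by positivity)
    have hq := HardCore.quadratic_pos hΔ' hα0 hβ0 hα hβ hR hvu
    obtain ⟨hγ, hδ, hε, hη, hb, hS, hM', hτ⟩ := hp
    have hL := HardCore.overlapEntropy_add_le (γ := γ) hα0 (by linarith) hγ (by linarith)
      (by linarith)
    have hRt := HardCore.overlapEntropy_add_le (γ := δ) hβ0 (by linarith) hδ (by linarith)
      (by linarith)
    rw [mul_add] at hM
    linarith
  · push Not at hvu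
    obtain rfl : γ = α ^ 2 := by linarith [hvu.1]
    obtain rfl : δ = β ^ 2 := by linarith [hvu.2]
    have hε : ε ≠ α * (1 - α - β) := fun h => hne (by rw [h])
    have hM := mul_lt_mul_of_pos_left (HardCore.matchingExponent_lt hα0 hβ0 hw hp hε)
      (show (0 : ℝ) < Δ by linarith)
    simp only [HardCore.overlapEntropy_sq]
    linarith
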